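/- Let $K$ be an algebraically closed field of characteristic zero, $S=K[x_0,\dots,x_n]$, and let $F,P\in S$ be a regular sequence of homogeneous polynomials of degree $d$ defining a smooth complete intersection in $\mathbb P^n=\operatorname{Proj} S$ (that is, the gradients of $F$ and $P$ are linearly independent at every common zero of $F$ and $P$ in $\mathbb P^n$). Let $s\ge 1$ and let $G_1,\dots,G_s\in[(F,P)]_d$ be nonzero forms of degree $d$ in the ideal $(F,P)$ defining $s$ distinct hypersurfaces of $\mathbb P^n$, i.e. $(G_i)\ne(G_j)$ for $i\neq j$. Put $G=\prod_{i=1}^s G_i$. Then $$\left(\frac{G}{G_1},\frac{G}{G_2},\dots,\frac{G}{G_s}\right)=(F,P)^{s-1}.$$ If moreover $n\ge 2$ and $s\ge 2$, then this ideal is the saturated homogeneous ideal $I_V$ of a closed subscheme $V\subset\mathbb P^n$ of codimension two which is arithmetically Cohen-Macaulay (that is, $S/I_V$ is a Cohen-Macaulay ring), whose support is the zero locus of $(F,P)$ in $\mathbb P^n$, and which has degree $\binom{s}{2}\cdot d^2$. -/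

import Mathlib

attribute [local instance] MvPolynomial.gradedAlgebra

/-- The depth of a local ring: the supremum of the lengths of the regular sequences
contained in its maximal ideal. -/
noncomputable def localRingDepth (R : Type*) [CommRing R] [IsLocalRing R] : ℕ∞ :=
  ⨆ rs ∈ {rs : List R | (∀ r ∈ rs, r ∈ IsLocalRing.maximalIdeal R) ∧
    RingTheory.Sequence.IsRegular R rs}, (rs.length : ℕ∞)

/-- A local ring is Cohen-Macaulay if it is Noetherian and its depth equals its dimension. -/
def IsCohenMacaulayLocal (R : Type*) [CommRing R] [IsLocalRing R] : Prop :=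
  IsNoetherianRing R ∧ (localRingDepth R : WithBot ℕ∞) = ringKrullDim R

/-- A ring is Cohen-Macaulay if it is Noetherian and its localizations at all maximal ideals
are Cohen-Macaulay local rings. -/
def IsCohenMacaulay (R : Type*) [CommRing R] : Prop :=
  IsNoetherianRing R ∧
    ∀ (m : Ideal R) [m.IsMaximal], IsCohenMacaulayLocal (Localization.AtPrime m)

/-- The irrelevant ideal `(x_0, …, x_n)` of `K[x_0, …, x_n]`. -/
noncomputable def irrelevantIdeal (n : ℕ) (K : Type*) [Field K] :
    Ideal (MvPolynomial (Fin (n + 1)) K) :=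
  Ideal.span (Set.range MvPolynomial.X)

/-- An ideal `I` is saturated with respect to the irrelevant ideal `𝔪` if every `f` with
`𝔪 ^ k * f ⊆ I` for some `k` is already in `I`. -/
def IsSaturatedIdeal {n : ℕ} {K : Type*} [Field K]
    (I : Ideal (MvPolynomial (Fin (n + 1)) K)) : Prop :=
  ∀ f : MvPolynomial (Fin (n + 1)) K,
    (∃ k : ℕ, ∀ g ∈ irrelevantIdeal n K ^ k, g * f ∈ I) → f ∈ I

/-- A closed subscheme `V` of `ℙⁿ` over `K`, given by its saturated homogeneous ideal `I_V`
(closed subschemes of `ℙⁿ` correspond bijectively to saturated homogeneous ideals of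
`K[x_0, …, x_n]`, the subscheme belonging to `I` being `Proj (K[x_0, …, x_n] / I)`). -/
structure ProjSubscheme (n : ℕ) (K : Type*) [Field K] where
  /-- the saturated homogeneous ideal of the subscheme -/
  ideal : Ideal (MvPolynomial (Fin (n + 1)) K)
  homogeneous : ideal.IsHomogeneous (MvPolynomial.homogeneousSubmodule (Fin (n + 1)) K)
  saturated : IsSaturatedIdeal ideal

namespace ProjSubscheme

variable {n : ℕ} {K : Type*} [Field K]

/-- The support of `V`: the closed set of points of `ℙⁿ = Proj K[x_0, …, x_n]` at which all
elements of `I_V` vanish. -/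
def support (V : ProjSubscheme n K) :
    Set (ProjectiveSpectrum (MvPolynomial.homogeneousSubmodule (Fin (n + 1)) K)) :=
  ProjectiveSpectrum.zeroLocus _ (V.ideal : Set (MvPolynomial (Fin (n + 1)) K))

/-- The codimension of `V` in `ℙⁿ`: the least height of (the homogeneous prime ideal of)
a point of the support; it is `⊤` if `V` is empty. -/
noncomputable def codim (V : ProjSubscheme n K) : ℕ∞ :=
  ⨅ p ∈ V.support, p.asHomogeneousIdeal.toIdeal.height

/-- `V` is arithmetically Cohen-Macaulay: its homogeneous coordinate ring `S / I_V` is a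
Cohen-Macaulay ring. -/
def IsACM (V : ProjSubscheme n K) : Prop :=
  IsCohenMacaulay (MvPolynomial (Fin (n + 1)) K ⧸ V.ideal)

/-- The Hilbert function `t ↦ dim_K [S / I_V]_t`. -/
noncomputable def hilbertFunction (V : ProjSubscheme n K) (t : ℕ) : ℕ :=
  Module.finrank K (MvPolynomial.homogeneousSubmodule (Fin (n + 1)) K t ⧸
    (V.ideal.restrictScalars K).comap
      (MvPolynomial.homogeneousSubmodule (Fin (n + 1)) K t).subtype)

/-- `V` has degree `e`: the Hilbert polynomial `p` of `V`, say of degree `r`, has leading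
coefficient `e / r!`. -/
def HasDegree (V : ProjSubscheme n K) (e : ℕ) : Prop :=
  ∃ p : Polynomial ℚ,
    (∀ᶠ t : ℕ in Filter.atTop, (V.hilbertFunction t : ℚ) = p.eval (t : ℚ)) ∧
    (p.natDegree.factorial : ℚ) * p.leadingCoeff = e

end ProjSubscheme

/-- The intersection of the hypersurfaces `F` and `P` of `ℙⁿ` is smooth of codimension two,
by the Jacobian criterion (`K` algebraically closed): at each common zero in `ℙⁿ`, the
gradients of `F` and `P` are linearly independent. -/
def IsSmoothIntersection {n : ℕ} {K : Type*} [Field K]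
    (F P : MvPolynomial (Fin (n + 1)) K) : Prop :=
  ∀ x : Fin (n + 1) → K, x ≠ 0 → MvPolynomial.eval x F = 0 → MvPolynomial.eval x P = 0 →
    LinearIndependent K ![fun k => MvPolynomial.eval x (MvPolynomial.pderiv k F),
      fun k => MvPolynomial.eval x (MvPolynomial.pderiv k P)]

/-! Let `I = (F, P)`. Comparing components of degree `d` shows that each `G i` is a combination of
`F` and `P` with constant coefficients. Distinct hypersurfaces give non-proportional combinations,
so any two of the `G i` generate `I`. This alone gives `I ^ (s - 1)` as the ideal of the products,
by induction on the number of factors (`Ideal.pow_le_span_prod_erase`).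

The geometric claims thus concern powers of an ideal generated by a regular sequence. For
Cohen-Macaulayness, cut by hypersurfaces `l` through a given closed point that avoid the minimal
primes of `I` and whose quotient is a polynomial ring in one variable fewer. The images of `F` and
`P` remain a regular sequence, which forces `l` to be a nonzerodivisor modulo every power of `I`.
Iterating gives `exists_weaklyRegularMod_span_pair_pow`: a sequence as long as the dimension of `S /
I ^ k`. Saturation follows from its first element at the origin.

The degree comes from `I ^ (k + 1) : F = I ^ k` and `I ^ (k + 1) + (F) = (F, P ^ (k + 1))`.
Multiplication by `F` (`finrank_quotient_idealPiece_sup`) then adds `(k + 1) * d ^ 2` to the degree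
at each step, and `1 + ... + (s - 1)` is `s.choose 2`. -/

/-! ### Prime avoidance by elements `X - g` -/

-- A vector space over an infinite field is not a finite union of proper subspaces. Elements `X - C
-- g` form only an affine family, so the space used is that of all `c • X - C b` in `m`, with `c =
-- 0` as one more subspace to avoid.
open Polynomial in
theorem exists_X_sub_C_mem_and_notMem {K B : Type*} [Field K] [Infinite K] [CommRing B]
    [Algebra K B] (m : Ideal B[X]) (g₀ : B) (hg₀ : X - C g₀ ∈ m) (s : Set (Ideal B[X]))
    (hs : s.Finite) (h : ∀ p ∈ s, ¬ m ≤ p) :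
    ∃ g : B, X - C g ∈ m ∧ ∀ p ∈ s, X - C g ∉ p := by
  by_contra! hcon
  have := hs.to_subtype
  let φ : K × B →ₗ[K] B[X] :=
    (LinearMap.toSpanSingleton K B[X] X).coprod (-(Algebra.ofId B B[X]).toLinearMap.restrictScalars K)
  have hφ : ∀ c b, φ (c, b) = c • X - C b := fun c b ↦ by
    simp [φ, Algebra.ofId_apply, sub_eq_add_neg]
  let W : Submodule K (K × B) := (m.restrictScalars K).comap φ
  let V : Option s → Subspace K W := fun o ↦ match o with
    | none => (LinearMap.fst K K B ∘ₗ W.subtype).ker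
    | some p => ((p.1.restrictScalars K).comap φ).comap W.subtype
  have hcov : ⋃ i, (V i : Set W) = Set.univ := by
    rw [Set.eq_univ_iff_forall]
    rintro ⟨⟨c, b⟩, hw⟩
    rw [Set.mem_iUnion]
    by_cases hc : c = 0
    · exact ⟨none, by simpa [V] using hc⟩
    · have hw' : c • X - C b ∈ m := by rw [← hφ]; exact hw
      have hsc : X - C (c⁻¹ • b) = c⁻¹ • (c • X - C b) := by
        rw [smul_sub, smul_smul, inv_mul_cancel₀ hc, one_smul, smul_C]
      obtain ⟨p, hp, hpm⟩ := hcon (c⁻¹ • b) (by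
        rw [hsc]; exact (m.restrictScalars K).smul_mem _ hw')
      refine ⟨some ⟨p, hp⟩, ?_⟩
      change φ (c, b) ∈ p
      rw [hφ]
      have : c • X - C b = c • (X - C (c⁻¹ • b)) := by
        rw [hsc, smul_smul, mul_inv_cancel₀ hc, one_smul]
      rw [this]
      exact (p.restrictScalars K).smul_mem _ hpm
  obtain ⟨i, hi⟩ := Subspace.exists_eq_top_of_iUnion_eq_univ hcov
  have hw₀ : ((1 : K), g₀) ∈ W := by
    change φ (1, g₀) ∈ m
    rw [hφ, one_smul]; exact hg₀
  rcases i with _ | ⟨p, hp⟩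
  · have : (⟨(1, g₀), hw₀⟩ : W) ∈ V none := by rw [hi]; trivial
    simp [V] at this
  · have key : ∀ w : W, φ w.1 ∈ p := fun w ↦ by
      have : w ∈ V (some ⟨p, hp⟩) := by rw [hi]; trivial
      exact this
    have h1 : X - C g₀ ∈ p := by
      have := key ⟨_, hw₀⟩
      rwa [hφ, one_smul] at this
    -- If `p` contains all these elements, it contains `X - C g₀` and every constant of `m`;
    -- division by `X - C g₀` then puts all of `m` in `p`.
    refine h p hp fun f hf ↦ ?_
    obtain ⟨q, hq⟩ := X_sub_C_dvd_sub_C_eval (a := g₀) (p := f)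
    have h2 : C (f.eval g₀) ∈ m := by
      have : C (f.eval g₀) = f - (X - C g₀) * q := by rw [← hq]; ring
      rw [this]; exact m.sub_mem hf (m.mul_mem_right _ hg₀)
    have h3 : C (f.eval g₀) ∈ p := by
      have := key ⟨(0, f.eval g₀), by
        change φ (0, f.eval g₀) ∈ m
        rw [hφ, zero_smul, zero_sub]; exact m.neg_mem h2⟩
      rw [hφ, zero_smul, zero_sub] at this
      exact neg_mem_iff.mp this
    have : f = (X - C g₀) * q + C (f.eval g₀) := by rw [← hq]; ring
    rw [this]; exact p.add_mem (p.mul_mem_right _ h1) h3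

/-! ### Powers of an ideal generated by a regular sequence of length two -/

theorem dvd_of_dvd_pow_mul {A : Type*} [CommRing A] {F P : A} (h : ∀ f, F ∣ P * f → F ∣ f)
    (j : ℕ) : ∀ f, F ∣ P ^ j * f → F ∣ f := by
  induction j with
  | zero => simp
  | succ j ih => exact fun f hf ↦ h f (ih _ (by rwa [pow_succ, mul_assoc] at hf))

/-- Among the monomials of degree `k + 1` in `F` and `P`, only `P ^ (k + 1)` lacks a factor `F`. -/
theorem Ideal.span_pair_pow_succ {A : Type*} [CommRing A] (F P : A) (k : ℕ) :
    Ideal.span {F, P} ^ (k + 1) =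
      Ideal.span {F} * Ideal.span {F, P} ^ k ⊔ Ideal.span {P ^ (k + 1)} := by
  have hs : Ideal.span {F, P} = Ideal.span {F} ⊔ Ideal.span {P} := Ideal.span_insert F {P}
  induction k with
  | zero => simp [hs]
  | succ k ih =>
    refine le_antisymm ?_ (sup_le ?_ ?_)
    · conv_lhs => rw [pow_succ, hs, Ideal.mul_sup]
      refine sup_le (by rw [← hs, mul_comm]; exact le_sup_left) ?_
      rw [← hs, ih, Ideal.sup_mul, Ideal.span_singleton_mul_span_singleton, ← pow_succ]
      refine sup_le_sup_right ?_ _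
      rw [mul_assoc, ← ih, pow_succ]
      exact Ideal.mul_mono_right (Ideal.mul_mono_right (hs ▸ le_sup_right))
    · rw [pow_succ' _ (k + 1)]
      exact Ideal.mul_mono_left (hs ▸ le_sup_left)
    · rw [← Ideal.span_singleton_pow]
      exact Ideal.pow_right_mono (hs ▸ le_sup_right) _

theorem Ideal.mem_span_pair_pow_succ {A : Type*} [CommRing A] {F P x : A} {k : ℕ} :
    x ∈ Ideal.span {F, P} ^ (k + 1) ↔
      ∃ a ∈ Ideal.span {F, P} ^ k, ∃ b, x = F * a + P ^ (k + 1) * b := by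
  rw [Ideal.span_pair_pow_succ, Submodule.mem_sup]
  simp only [Ideal.mem_span_singleton_mul, Ideal.mem_span_singleton]
  constructor
  · rintro ⟨_, ⟨a, ha, rfl⟩, _, ⟨b, rfl⟩, rfl⟩
    exact ⟨a, ha, b, rfl⟩
  · rintro ⟨a, ha, b, rfl⟩
    exact ⟨_, ⟨a, ha, rfl⟩, _, ⟨b, rfl⟩, rfl⟩

/-- In `F * g = F * a + P ^ (k + 1) * b`, regularity makes `b` a multiple of `F`, and `F` cancels.
-/
theorem Ideal.mem_span_pair_pow_of_mul_mem {A : Type*} [CommRing A] [IsDomain A] {F P : A}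
    (hF : F ≠ 0) (hP : ∀ f, F ∣ P * f → F ∣ f) {k : ℕ} {g : A}
    (h : F * g ∈ Ideal.span {F, P} ^ (k + 1)) : g ∈ Ideal.span {F, P} ^ k := by
  obtain ⟨a, ha, b, hab⟩ := Ideal.mem_span_pair_pow_succ.1 h
  obtain ⟨c, rfl⟩ := dvd_of_dvd_pow_mul hP (k + 1) b ⟨g - a, by linear_combination -hab⟩
  have : g = a + P ^ (k + 1) * c := mul_left_cancel₀ hF (by linear_combination hab)
  rw [this]
  exact add_mem ha (Ideal.mul_mem_right _ _ (Ideal.pow_le_pow_right (Nat.le_succ k)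
    (Ideal.pow_mem_pow (Ideal.subset_span (by simp)) _)))

/-- Write `l * v = F * a + P ^ (k + 1) * b`. Modulo `l` this is a relation between `F` and `P ^ (k +
1)`, hence a trivial one. Correcting `a` and `b` by a lift of it makes both divisible by `l`, and
induction on `k` applies to the quotient of the corrected `a`. -/
theorem Ideal.mem_span_pair_pow_of_mul_mem_of_quotient {A A' : Type*} [CommRing A] [IsDomain A]
    [CommRing A'] [IsDomain A'] {F P l : A} (hl : l ≠ 0) (φ : A →+* A') (hφ : Function.Surjective φ) (hk : ∀ x, φ x = 0 ↔ l ∣ x)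
    (hF' : φ F ≠ 0) (hP' : ∀ f, φ F ∣ φ P * f → φ F ∣ f) (k : ℕ) (v : A)
    (h : l * v ∈ Ideal.span {F, P} ^ k) : v ∈ Ideal.span {F, P} ^ k := by
  induction k generalizing v with
  | zero => simp
  | succ k ih =>
    obtain ⟨a, ha, b, hab⟩ := Ideal.mem_span_pair_pow_succ.1 h
    have h0 : φ F * φ a + φ P ^ (k + 1) * φ b = 0 := by
      rw [← map_pow, ← map_mul, ← map_mul, ← map_add, ← hab, hk]; exact ⟨v, rfl⟩
    obtain ⟨c', hc'⟩ := dvd_of_dvd_pow_mul hP' (k + 1) (φ b) ⟨-φ a, by linear_combination h0⟩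
    obtain ⟨c, rfl⟩ := hφ c'
    obtain ⟨b₁, hb₁⟩ := (hk (b - F * c)).1 (by simp [hc'])
    obtain ⟨a₁, ha₁⟩ := (hk (a + P ^ (k + 1) * c)).1 (by
      refine (mul_eq_zero.1 ?_).resolve_left hF'
      simp only [map_add, map_mul, map_pow]
      linear_combination h0 - φ P ^ (k + 1) * hc')
    have hv : v = F * a₁ + P ^ (k + 1) * b₁ := mul_left_cancel₀ hl (by
      linear_combination hab + F * ha₁ + P ^ (k + 1) * hb₁)
    have h1 : l * a₁ ∈ Ideal.span {F, P} ^ k := by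
      rw [← ha₁]
      exact add_mem ha (Ideal.mul_mem_right _ _ (Ideal.pow_le_pow_right (Nat.le_succ k)
        (Ideal.pow_mem_pow (Ideal.subset_span (by simp)) _)))
    exact Ideal.mem_span_pair_pow_succ.2 ⟨a₁, ih _ h1, b₁, hv⟩

/-! ### Heights, and regular sequences modulo all powers -/

/-- A common prime factor would generate a prime of height at most one. The ideal `m` serves to
exclude `F = 0`, where `P` itself is the common factor. -/
theorem ne_zero_and_dvd_of_two_le_height {A : Type*} [CommRing A] [IsDomain A]
    [UniqueFactorizationMonoid A] [IsNoetherianRing A] {F P : A} (m : Ideal A)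
    [m.IsPrime] (hPm : P ∈ m) (h : ∀ q : Ideal A, q.IsPrime → F ∈ q → P ∈ q → 2 ≤ q.height) :
    F ≠ 0 ∧ ∀ f, F ∣ P * f → F ∣ f := by
  have key : ∀ c : A, c ∣ F → c ∣ P → c ∈ m → False := fun c hcF hcP hc ↦ by
    obtain ⟨q, hq, hqm⟩ := Ideal.exists_minimalPrimes_le ((Ideal.span_singleton_le_iff_mem m).2 hc)
    have h1 := Ideal.height_le_one_of_isPrincipal_of_mem_minimalPrimes _ q hq
    have hc' : c ∈ q := hq.1.2 (Ideal.mem_span_singleton_self c)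
    have h2 := h q hq.1.1 (q.mem_of_dvd hcF hc') (q.mem_of_dvd hcP hc')
    exact absurd (h2.trans h1) (by norm_num)
  have hF : F ≠ 0 := fun h0 ↦ key P (h0 ▸ dvd_zero P) dvd_rfl hPm
  refine ⟨hF, fun f hf ↦ ?_⟩
  have hrel : IsRelPrime F P := by
    refine WfDvdMonoid.isRelPrime_of_no_irreducible_factors (fun h ↦ hF h.1) fun z hz hzF hzP ↦ ?_
    have hzp := hz.prime
    have hprime : (Ideal.span {z}).IsPrime := (Ideal.span_singleton_prime hzp.ne_zero).2 hzp
    have h1 := Ideal.height_span_singleton_le_one hz.not_isUnit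
    have h2 := h _ hprime (Ideal.mem_span_singleton.2 hzF) (Ideal.mem_span_singleton.2 hzP)
    exact absurd (h2.trans h1) (by norm_num)
  exact hrel.dvd_of_dvd_mul_left hf

theorem MvPolynomial.height_of_isMaximal {K : Type*} [Field K] (n : ℕ)
    (m : Ideal (MvPolynomial (Fin n) K)) [hm : m.IsMaximal] : m.height = n := by
  induction n with
  | zero =>
    have : m = ⊥ := by
      let e := MvPolynomial.isEmptyRingEquiv K (Fin 0)
      have := (MulEquiv.isField (Field.toIsField K) e.toMulEquiv)
      let := this.toField
      exact (Ideal.eq_bot_or_top m).resolve_right hm.ne_top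
    rw [this, Ideal.height_bot]; rfl
  | succ n ih =>
    let e := (MvPolynomial.finSuccEquiv K n).toRingEquiv
    let M := m.map e
    have hM : M.IsMaximal := Ideal.map_isMaximal_of_equiv e
    have : (M.under (MvPolynomial (Fin n) K)).IsMaximal :=
      Polynomial.isMaximal_comap_C_of_isJacobsonRing M
    have : M.LiesOver (M.under (MvPolynomial (Fin n) K)) := ⟨rfl⟩
    rw [← e.height_map m, Polynomial.height_eq_height_add_one (M.under _) M, ih]
    push_cast; rfl

/-- A list of ring elements is weakly regular modulo an ideal `J` if each of its entries is a
nonzerodivisor modulo `J` and the preceding entries. -/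
def WeaklyRegularMod {A : Type*} [CommRing A] : Ideal A → List A → Prop
  | _, [] => True
  | J, r :: rs => (∀ f, r * f ∈ J → f ∈ J) ∧ WeaklyRegularMod (J ⊔ Ideal.span {r}) rs

theorem WeaklyRegularMod.comap {A A' : Type*} [CommRing A] [CommRing A'] (φ : A →+* A')
    (hφ : Function.Surjective φ) (rs : List A) (J : Ideal A')
    (h : WeaklyRegularMod J (rs.map φ)) : WeaklyRegularMod (J.comap φ) rs := by
  induction rs generalizing J with
  | nil => trivial
  | cons r rs ih =>
    refine ⟨fun f hf ↦ h.1 _ (by simpa using hf), ?_⟩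
    have : J.comap φ ⊔ Ideal.span {r} = (J ⊔ Ideal.span {φ r}).comap φ := by
      have h1 : J ⊔ Ideal.span {φ r} = (J.comap φ ⊔ Ideal.span {r}).map φ := by
        rw [Ideal.map_sup, Ideal.map_comap_of_surjective φ hφ, Ideal.map_span,
          Set.image_singleton]
      have h2 : Ideal.comap φ ⊥ ≤ J.comap φ ⊔ Ideal.span {r} :=
        le_trans (Ideal.comap_mono bot_le) le_sup_left
      rw [h1, Ideal.comap_map_of_surjective φ hφ, sup_eq_left.2 h2]
    rw [this]
    exact ih _ h.2

/-- By the Nullstellensatz `m` is the ideal of a point `a`, so it contains `X 0 - C (a 0)`, the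
starting element for the avoidance. The resulting `l` is monic linear in the first variable, and `φ`
substitutes its root. -/
theorem exists_notMem_minimalPrimes_quotient {K : Type*} [Field K] [IsAlgClosed K] (n : ℕ)
    (m : Ideal (MvPolynomial (Fin (n + 1)) K)) [hm : m.IsMaximal]
    (s : Set (Ideal (MvPolynomial (Fin (n + 1)) K))) (hs : s.Finite) (h : ∀ p ∈ s, ¬ m ≤ p) :
    ∃ l ∈ m, (∀ p ∈ s, l ∉ p) ∧ ∃ φ : MvPolynomial (Fin (n + 1)) K →+* MvPolynomial (Fin n) K,
      Function.Surjective φ ∧ ∀ x, φ x = 0 ↔ l ∣ x := by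
  have : Infinite K := IsAlgClosed.instInfinite
  let e := MvPolynomial.finSuccEquiv K n
  obtain ⟨a, rfl⟩ := MvPolynomial.isMaximal_iff_eq_vanishingIdeal_singleton.1 hm
  set m := MvPolynomial.vanishingIdeal K {a}
  obtain ⟨g, hgm, hg⟩ := exists_X_sub_C_mem_and_notMem (K := K) (m.comap e.symm)
    (MvPolynomial.C (a 0)) (by
      have : e.symm (Polynomial.X - Polynomial.C (MvPolynomial.C (a 0))) =
          MvPolynomial.X 0 - MvPolynomial.C (a 0) := by
        rw [AlgEquiv.symm_apply_eq]
        simp [e, MvPolynomial.finSuccEquiv_apply]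
      rw [Ideal.mem_comap, this, MvPolynomial.mem_vanishingIdeal_singleton_iff]
      simp)
    ((fun p ↦ p.comap e.symm) '' s) (hs.image _) (by
      rintro _ ⟨p, hp, rfl⟩ hle
      refine h p hp fun x hx ↦ ?_
      have := hle (show e x ∈ _ by rw [Ideal.mem_comap]; simpa using hx)
      rw [Ideal.mem_comap] at this
      simpa using this)
  refine ⟨e.symm (Polynomial.X - Polynomial.C g), hgm, fun p hp hl ↦ hg _ ⟨p, hp, rfl⟩ hl,
    (Polynomial.evalRingHom g).comp e.toRingEquiv.toRingHom, ?_, fun x ↦ ?_⟩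
  · exact fun b ↦ ⟨e.symm (Polynomial.C b), by simp⟩
  · rw [← map_dvd_iff e, AlgEquiv.apply_symm_apply, Polynomial.dvd_iff_isRoot]
    rfl

/-- The preimage of `q` contains `l`, so it lies strictly above a minimal prime of `(F, P)` and has
height at least three; killing `l` lowers the height by at most one. -/
theorem two_le_height_of_quotient {A A' : Type*} [CommRing A] [CommRing A'] [IsNoetherianRing A]
    {F P l : A} (hh : ∀ q : Ideal A, q.IsPrime → F ∈ q → P ∈ q → 2 ≤ q.height)
    (hl : ∀ p ∈ (Ideal.span {F, P}).minimalPrimes, l ∉ p)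
    (φ : A →+* A') (hφ : Function.Surjective φ) (hk : ∀ x, φ x = 0 ↔ l ∣ x)
    (q : Ideal A') (hq : q.IsPrime) (hF : φ F ∈ q) (hP : φ P ∈ q) : 2 ≤ q.height := by
  let Q := q.comap φ
  have hQ : Q.IsPrime := Ideal.comap_isPrime φ q
  have hlQ : l ∈ Q := by
    rw [Ideal.mem_comap, (hk l).2 dvd_rfl]; exact q.zero_mem
  obtain ⟨p, hp, hpQ⟩ := Ideal.exists_minimalPrimes_le (I := Ideal.span {F, P}) (J := Q) (by
    rw [Ideal.span_le]; rintro x (rfl | rfl) <;> assumption)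
  have hpp : p.IsPrime := hp.1.1
  have h2 : 2 ≤ p.height := hh p hpp (hp.1.2 (Ideal.subset_span (by simp)))
    (hp.1.2 (Ideal.subset_span (by simp)))
  have hlt : p < Q := lt_of_le_of_ne hpQ (fun h ↦ hl p hp (h ▸ hlQ))
  have h3 := Ideal.height_add_one_le_of_lt_of_isPrime hlt
  have h4 := Ideal.height_le_height_add_one_of_mem hlQ
  have hker : RingHom.ker φ = Ideal.span {l} := by
    ext x; rw [RingHom.mem_ker, hk, Ideal.mem_span_singleton]
  let e : (A ⧸ Ideal.span {l}) ≃+* A' :=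
    (Ideal.quotEquivOfEq hker.symm).trans (RingHom.quotientKerEquivOfSurjective hφ)
  have he : (Q.map (Ideal.Quotient.mk (Ideal.span {l}))).height = q.height := by
    rw [← e.height_map, show (Q.map _).map e = Q.map φ by
      rw [← Ideal.map_coe e, Ideal.map_map]; congr 1, Ideal.map_comap_of_surjective φ hφ]
  rw [he] at h4
  have h5 : (2 : ℕ∞) + 1 ≤ q.height + 1 := (add_le_add_left h2 1).trans (h3.trans h4)
  exact (ENat.add_le_add_iff_right (by simp)).1 h5

theorem Ideal.height_le_two_of_mem_minimalPrimes {A : Type*} [CommRing A] [IsNoetherianRing A]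
    {F P : A} {p : Ideal A} (hp : p ∈ (Ideal.span {F, P}).minimalPrimes) : p.height ≤ 2 := by
  classical
  have h := Ideal.height_le_card_of_mem_minimalPrimes_span_finset (s := {F, P}) (p := p)
    (by simpa using hp)
  exact h.trans (by exact_mod_cast Finset.card_le_two)

/-- Induction on the number of variables. The height condition, unlike a chosen presentation, passes
to the quotient by `l`, and the same list serves all `k`. -/
theorem exists_weaklyRegularMod_span_pair_pow {K : Type*} [Field K] [IsAlgClosed K] (n : ℕ)
    (F P : MvPolynomial (Fin (n + 2)) K) (m : Ideal (MvPolynomial (Fin (n + 2)) K))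
    [hm : m.IsMaximal] (hF : F ∈ m) (hP : P ∈ m)
    (hh : ∀ q : Ideal (MvPolynomial (Fin (n + 2)) K), q.IsPrime → F ∈ q → P ∈ q → 2 ≤ q.height) :
    ∃ rs : List (MvPolynomial (Fin (n + 2)) K), rs.length = n ∧ (∀ r ∈ rs, r ∈ m) ∧
      ∀ k, WeaklyRegularMod (Ideal.span {F, P} ^ k) rs := by
  induction n with
  | zero => exact ⟨[], rfl, by simp, fun _ ↦ trivial⟩
  | succ n ih =>
    obtain ⟨l, hlm, hl, φ, hφ, hk⟩ := exists_notMem_minimalPrimes_quotient (n + 2) m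
      (Ideal.span {F, P}).minimalPrimes (Ideal.finite_minimalPrimes_of_isNoetherianRing _ _)
      -- The minimal primes have height at most two, while `m` has height `n + 3`.
      (fun p hp hle ↦ by
        have h := (Ideal.height_mono hle).trans (Ideal.height_le_two_of_mem_minimalPrimes hp)
        rw [MvPolynomial.height_of_isMaximal] at h
        norm_cast at h)
    have hh' := two_le_height_of_quotient hh hl φ hφ hk
    have hker : RingHom.ker φ = Ideal.span {l} := by
      ext x; rw [RingHom.mem_ker, hk, Ideal.mem_span_singleton]
    have hle : RingHom.ker φ ≤ m := by rwa [hker, Ideal.span_singleton_le_iff_mem]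
    have hm' : (m.map φ).IsMaximal := Ideal.IsMaximal.map_of_surjective_of_ker_le hφ hle
    have hF' := Ideal.mem_map_of_mem φ hF
    have hP' := Ideal.mem_map_of_mem φ hP
    obtain ⟨rs', hlen, hmem, hreg⟩ := ih (φ F) (φ P) (m.map φ) hF' hP' hh'
    obtain ⟨hF0, hdvd⟩ := ne_zero_and_dvd_of_two_le_height (m.map φ) hP' hh'
    have hl0 : l ≠ 0 := by
      rintro rfl
      obtain ⟨p, hp⟩ := Ideal.exists_minimalPrimes_le (I := Ideal.span {F, P}) (J := m) (by
        rw [Ideal.span_le]; rintro x (rfl | rfl) <;> assumption)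
      exact hl p hp.1 p.zero_mem
    have hmap : (rs'.map (Function.surjInv hφ)).map φ = rs' := by
      rw [List.map_map, (Function.rightInverse_surjInv hφ).comp_eq_id, List.map_id]
    refine ⟨l :: rs'.map (Function.surjInv hφ), by simp [hlen], ?_, fun k ↦ ⟨fun f hf ↦
      Ideal.mem_span_pair_pow_of_mul_mem_of_quotient hl0 φ hφ hk hF0 hdvd k f hf, ?_⟩⟩
    · simp only [List.mem_cons, List.mem_map]
      rintro r (rfl | ⟨r', hr', rfl⟩)
      · exact hlm
      · have : Function.surjInv hφ r' ∈ (m.map φ).comap φ := by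
          rw [Ideal.mem_comap, Function.surjInv_eq hφ]; exact hmem _ hr'
        rwa [Ideal.comap_map_of_surjective φ hφ, sup_eq_left.2 (show Ideal.comap φ ⊥ ≤ m from hle)] at this
    · have : Ideal.span {F, P} ^ k ⊔ Ideal.span {l} = (Ideal.span {φ F, φ P} ^ k).comap φ := by
        have : Ideal.span {φ F, φ P} ^ k = (Ideal.span {F, P} ^ k).map φ := by
          rw [Ideal.map_pow, Ideal.map_span, Set.image_pair]
        rw [this, Ideal.comap_map_of_surjective φ hφ, ← hker]; rfl
      rw [this]
      exact WeaklyRegularMod.comap φ hφ _ _ (by rw [hmap]; exact hreg k)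

/-! ### Regular sequences, dimension and Cohen-Macaulay quotients -/

-- The module is an arbitrary cyclic `M` with annihilating kernel `J`, so that the induction can
-- pass from `M` to `M / rM`.
open RingTheory.Sequence in
theorem WeaklyRegularMod.isWeaklyRegular {A M : Type*} [CommRing A] [AddCommGroup M] [Module A M]
    (J : Ideal A) (rs : List A) (h : WeaklyRegularMod J rs) (f : A →ₗ[A] M)
    (hf : Function.Surjective f) (hJ : ∀ x, f x = 0 ↔ x ∈ J) : IsWeaklyRegular M rs := by
  induction rs generalizing M J with
  | nil => simp
  | cons r rs ih =>
    rw [isWeaklyRegular_cons_iff]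
    refine ⟨isSMulRegular_iff_right_eq_zero_of_smul.2 fun m hm ↦ ?_,
      ih _ h.2 ((Submodule.mkQ _).comp f) ((Submodule.mkQ_surjective _).comp hf) fun x ↦ ?_⟩
    · obtain ⟨a, rfl⟩ := hf m
      rw [← map_smul, hJ] at hm
      exact (hJ a).2 (h.1 a hm)
    · rw [LinearMap.comp_apply, Submodule.mkQ_apply, Submodule.Quotient.mk_eq_zero,
        Submodule.mem_smul_pointwise_iff_exists, Submodule.mem_sup]
      constructor
      · rintro ⟨m, -, hm⟩
        obtain ⟨a, rfl⟩ := hf m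
        refine ⟨x - r * a, (hJ _).1 ?_, r * a, Ideal.mem_span_singleton.2 ⟨a, rfl⟩, by ring⟩
        rw [map_sub, ← smul_eq_mul, map_smul, hm, sub_self]
      · rintro ⟨y, hy, z, hz, rfl⟩
        obtain ⟨a, rfl⟩ := Ideal.mem_span_singleton.1 hz
        exact ⟨f a, trivial, by rw [map_add, (hJ y).2 hy, zero_add, ← smul_eq_mul, map_smul]⟩

open RingTheory.Sequence in
theorem ne_zero_and_dvd_of_isWeaklyRegular {A : Type*} [CommRing A] [Nontrivial A] {F P : A}
    (h : IsWeaklyRegular A [F, P]) : F ≠ 0 ∧ ∀ f, F ∣ P * f → F ∣ f := by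
  rw [isWeaklyRegular_cons_iff, isWeaklyRegular_singleton_iff] at h
  refine ⟨?_, fun f hf ↦ ?_⟩
  · rintro rfl
    exact one_ne_zero (isSMulRegular_iff_right_eq_zero_of_smul.1 h.1 1 (by simp))
  · have := isSMulRegular_iff_right_eq_zero_of_smul.1 h.2 (Submodule.Quotient.mk f) (by
      rw [← Submodule.Quotient.mk_smul, Submodule.Quotient.mk_eq_zero,
        Submodule.mem_smul_pointwise_iff_exists]
      obtain ⟨c, hc⟩ := hf
      exact ⟨c, trivial, hc.symm⟩)
    rw [Submodule.Quotient.mk_eq_zero, Submodule.mem_smul_pointwise_iff_exists] at this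
    obtain ⟨c, -, hc⟩ := this
    exact ⟨c, hc.symm⟩

theorem mk_mem_nonZeroDivisors_of_dvd {A : Type*} [CommRing A] {F P : A}
    (hP : ∀ f, F ∣ P * f → F ∣ f) :
    Ideal.Quotient.mk (Ideal.span {F}) P ∈ nonZeroDivisors (A ⧸ Ideal.span {F}) := by
  rw [mem_nonZeroDivisors_iff_right]
  intro x hx
  obtain ⟨x, rfl⟩ := Ideal.Quotient.mk_surjective x
  rw [← map_mul, Ideal.Quotient.eq_zero_iff_mem, Ideal.mem_span_singleton, mul_comm] at hx
  exact Ideal.Quotient.eq_zero_iff_mem.2 (Ideal.mem_span_singleton.2 (hP x hx))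

/-- A minimal prime of `(F)` inside `q` is nonzero, and it misses `P`, a nonzerodivisor modulo `F`;
this gives a chain of length two. -/
theorem two_le_height_of_dvd {A : Type*} [CommRing A] [IsDomain A] {F P : A}
    (hF : F ≠ 0) (hP : ∀ f, F ∣ P * f → F ∣ f) (q : Ideal A) (hq : q.IsPrime) (hFq : F ∈ q)
    (hPq : P ∈ q) : 2 ≤ q.height := by
  obtain ⟨p, hp, hpq⟩ := Ideal.exists_minimalPrimes_le ((Ideal.span_singleton_le_iff_mem q).2 hFq)
  have hpp : p.IsPrime := hp.1.1
  have hFp : F ∈ p := hp.1.2 (Ideal.mem_span_singleton_self F)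
  have hPp : P ∉ p := fun h ↦ by
    rw [Ideal.minimalPrimes_eq_comap] at hp
    obtain ⟨p', hp', rfl⟩ := hp
    exact Set.disjoint_left.1 (Ideal.disjoint_nonZeroDivisors_of_mem_minimalPrimes hp')
      h (mk_mem_nonZeroDivisors_of_dvd hP)
  have h1 : ⊥ < p := bot_lt_iff_ne_bot.2 fun h ↦ hF (by simpa [h] using hFp)
  have h2 : p < q := lt_of_le_of_ne hpq fun h ↦ hPp (h ▸ hPq)
  have h3 := Ideal.height_add_one_le_of_lt_of_isPrime h1
  have h4 := Ideal.height_add_one_le_of_lt_of_isPrime h2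
  rw [Ideal.height_bot, zero_add] at h3
  exact le_trans (by rw [← one_add_one_eq_two]; gcongr) h4

theorem ringKrullDim_quotient_span_pair_pow_le {A : Type*} [CommRing A] [IsDomain A] {F P : A}
    (hF : F ≠ 0) (hP : ∀ f, F ∣ P * f → F ∣ f) {k : ℕ} (hk : k ≠ 0) :
    ringKrullDim (A ⧸ Ideal.span {F, P} ^ k) + 1 + 1 ≤ ringKrullDim A := by
  have h0 : ringKrullDim (A ⧸ Ideal.span {F, P} ^ k) = ringKrullDim (A ⧸ Ideal.span {F, P}) := by
    rw [ringKrullDim_quotient, ringKrullDim_quotient, PrimeSpectrum.zeroLocus_pow _ hk]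
  have h1 := ringKrullDim_quotient_succ_le_of_nonZeroDivisor (mem_nonZeroDivisors_of_ne_zero hF)
  have hle : Ideal.span {F} ≤ Ideal.span {F, P} := Ideal.span_mono (by simp)
  have h2 := ringKrullDim_succ_le_of_surjective (Ideal.Quotient.factor hle)
    (Ideal.Quotient.factor_surjective hle) (mk_mem_nonZeroDivisors_of_dvd hP) (by
      rw [Ideal.Quotient.factor_mk, Ideal.Quotient.eq_zero_iff_mem]
      exact Ideal.subset_span (by simp))
  rw [h0]
  exact (add_le_add_left h2 1).trans h1

theorem localRingDepth_le_ringKrullDim (R : Type*) [CommRing R] [IsLocalRing R]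
    [IsNoetherianRing R] : (localRingDepth R : WithBot ℕ∞) ≤ ringKrullDim R := by
  obtain ⟨D, hD⟩ : ∃ D : ℕ∞, (D : WithBot ℕ∞) = ringKrullDim R :=
    WithBot.ne_bot_iff_exists.1 ringKrullDim_ne_bot
  rw [← hD, WithBot.coe_le_coe]
  refine iSup₂_le fun rs hrs ↦ ?_
  have h := ringKrullDim_add_length_eq_ringKrullDim_of_isRegular rs hrs.2
  have hnt : Nontrivial (R ⧸ Ideal.ofList rs) := by
    have := hrs.2.top_ne_smul
    rw [Ideal.Quotient.nontrivial_iff]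
    simpa using this.symm
  rw [← WithBot.coe_le_coe, hD, ← h]
  exact le_add_of_nonneg_left ringKrullDim_nonneg_of_nontrivial

-- The local dimension is at most `n`, hence at most the depth witnessed by the list; the reverse
-- inequality always holds.
open RingTheory.Sequence in
theorem isCohenMacaulay_quotient_of_weaklyRegularMod {A : Type*} [CommRing A] [IsNoetherianRing A]
    (J : Ideal A) (n : ℕ) (hdim : ringKrullDim (A ⧸ J) ≤ n)
    (h : ∀ m : Ideal A, m.IsMaximal → J ≤ m → ∃ rs : List A, rs.length = n ∧ (∀ r ∈ rs, r ∈ m) ∧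
      WeaklyRegularMod J rs) : IsCohenMacaulay (A ⧸ J) := by
  refine ⟨inferInstance, fun m hm ↦ ⟨IsLocalization.isNoetherianRing m.primeCompl _ inferInstance,
    le_antisymm ?_ ?_⟩⟩
  · have : IsNoetherianRing (Localization.AtPrime m) :=
      IsLocalization.isNoetherianRing m.primeCompl _ inferInstance
    exact localRingDepth_le_ringKrullDim _
  · have hle : J ≤ m.comap (Ideal.Quotient.mk J) := fun x hx ↦ by
      rw [Ideal.mem_comap, Ideal.Quotient.eq_zero_iff_mem.2 hx]; exact m.zero_mem
    obtain ⟨rs, hlen, hmem, hreg⟩ := h _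
      (Ideal.comap_isMaximal_of_surjective _ Ideal.Quotient.mk_surjective) hle
    have h1 : IsWeaklyRegular (A ⧸ J) rs := hreg.isWeaklyRegular J rs
      (Submodule.mkQ J) (Submodule.mkQ_surjective J) (fun x ↦ Ideal.Quotient.eq_zero_iff_mem)
    rw [← isWeaklyRegular_map_algebraMap_iff (A ⧸ J)] at h1
    have h2 := h1.isRegular_of_isLocalization_of_mem (Localization.AtPrime m) m (by
      simp only [List.mem_map]
      rintro _ ⟨r, hr, rfl⟩
      exact hmem r hr)
    rw [IsLocalization.AtPrime.ringKrullDim_eq_height m]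
    refine (Ideal.height_le_ringKrullDim_of_isPrime.trans hdim).trans ?_
    have h3 : (n : ℕ∞) ≤ localRingDepth (Localization.AtPrime m) := by
      refine le_trans (by simp [hlen]) (le_iSup₂ (f := fun rs _ ↦ (List.length rs : ℕ∞)) _ ⟨?_, h2⟩)
      simp only [List.mem_map]
      rintro _ ⟨_, ⟨r, hr, rfl⟩, rfl⟩
      exact (IsLocalization.AtPrime.to_map_mem_maximal_iff _ m _).2 (hmem r hr)
    exact_mod_cast WithBot.coe_le_coe.2 h3

/-! ### Homogeneous ideals, saturation and the arithmetically Cohen-Macaulay property -/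

theorem irrelevantIdeal_eq_vanishingIdeal (n : ℕ) (K : Type*) [Field K] :
    irrelevantIdeal n K = MvPolynomial.vanishingIdeal K {(0 : Fin (n + 1) → K)} := by
  ext f
  rw [irrelevantIdeal, ← Set.image_univ, MvPolynomial.mem_ideal_span_X_image,
    MvPolynomial.mem_vanishingIdeal_singleton_iff, MvPolynomial.aeval_zero,
    Algebra.algebraMap_self_apply, MvPolynomial.constantCoeff_eq]
  constructor
  · intro h
    by_contra h0
    obtain ⟨i, -, hi⟩ := h 0 (MvPolynomial.mem_support_iff.2 h0)
    exact hi rfl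
  · intro h m hm
    by_contra! h'
    have : m = 0 := Finsupp.ext fun i ↦ h' i trivial
    exact MvPolynomial.mem_support_iff.1 hm (this ▸ h)

instance irrelevantIdeal_isMaximal (n : ℕ) (K : Type*) [Field K] :
    (irrelevantIdeal n K).IsMaximal := by
  rw [irrelevantIdeal_eq_vanishingIdeal]; infer_instance

theorem MvPolynomial.IsHomogeneous.mem_irrelevantIdeal {n d : ℕ} {K : Type*} [Field K]
    {F : MvPolynomial (Fin (n + 1)) K} (hF : F.IsHomogeneous d) (hd : d ≠ 0) :
    F ∈ irrelevantIdeal n K := by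
  rw [irrelevantIdeal_eq_vanishingIdeal, MvPolynomial.mem_vanishingIdeal_singleton_iff,
    MvPolynomial.aeval_zero, Algebra.algebraMap_self_apply, MvPolynomial.constantCoeff_eq]
  exact hF.coeff_eq_zero (by simpa using hd.symm)

theorem Ideal.IsHomogeneous.pow_nat {n : ℕ} {K : Type*} [Field K]
    {I : Ideal (MvPolynomial (Fin (n + 1)) K)}
    (hI : I.IsHomogeneous (MvPolynomial.homogeneousSubmodule (Fin (n + 1)) K)) (k : ℕ) :
    (I ^ k).IsHomogeneous (MvPolynomial.homogeneousSubmodule (Fin (n + 1)) K) := by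
  induction k with
  | zero => rw [pow_zero, Ideal.one_eq_top]; exact Ideal.IsHomogeneous.top (MvPolynomial.homogeneousSubmodule (Fin (n + 1)) K)
  | succ k ih => rw [pow_succ]; exact ih.mul hI

/-- The homogeneous core of `p` is again a prime containing `I`, so minimality makes it equal to
`p`. -/
theorem Ideal.IsHomogeneous.of_mem_minimalPrimes {A σ : Type*} [CommRing A] [SetLike σ A]
    [AddSubmonoidClass σ A] (𝒜 : ℕ → σ) [GradedRing 𝒜] {I p : Ideal A} (hI : I.IsHomogeneous 𝒜)
    (hp : p ∈ I.minimalPrimes) : p.IsHomogeneous 𝒜 := by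
  have hcore := Ideal.toIdeal_homogeneousCore_le 𝒜 p
  have hle : I ≤ (p.homogeneousCore 𝒜).toIdeal := by
    rw [← hI.toIdeal_homogeneousCore_eq_self]
    exact Ideal.homogeneousCore_mono 𝒜 hp.1.2
  rw [Ideal.IsHomogeneous.iff_eq]
  exact le_antisymm hcore (hp.2 ⟨Ideal.IsPrime.homogeneousCore hp.1.1, hle⟩ hcore)

theorem Ideal.isHomogeneous_span_pair {n d : ℕ} {K : Type*} [Field K]
    {F P : MvPolynomial (Fin (n + 1)) K} (hF : F.IsHomogeneous d) (hP : P.IsHomogeneous d) :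
    (Ideal.span {F, P}).IsHomogeneous (MvPolynomial.homogeneousSubmodule (Fin (n + 1)) K) :=
  Ideal.homogeneous_span _ _ (by rintro x (rfl | rfl); exacts [⟨d, hF⟩, ⟨d, hP⟩])

theorem WithBot.le_natCast_of_add_two_le {D : WithBot ℕ∞} {n : ℕ}
    (h : D + 1 + 1 ≤ ((n + 3 : ℕ) : WithBot ℕ∞)) : D ≤ ((n + 1 : ℕ) : WithBot ℕ∞) := by
  cases D with
  | bot => exact bot_le
  | coe D =>
    have h' : D + 1 + 1 ≤ ((n + 3 : ℕ) : ℕ∞) := WithBot.coe_le_coe.1 h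
    refine WithBot.coe_le_coe.2 (?_ : D ≤ ((n + 1 : ℕ) : ℕ∞))
    cases D with
    | top => simp at h'
    | coe D =>
      norm_cast at h' ⊢
      omega

section CompleteIntersection

variable {K : Type*} [Field K] [IsAlgClosed K] {n : ℕ} {F P : MvPolynomial (Fin (n + 3)) K}

theorem isSaturatedIdeal_span_pair_pow
    (hF0 : F ≠ 0) (hdvd : ∀ f, F ∣ P * f → F ∣ f) (hF : F ∈ irrelevantIdeal (n + 2) K)
    (hP : P ∈ irrelevantIdeal (n + 2) K) (k : ℕ) : IsSaturatedIdeal (Ideal.span {F, P} ^ k) := by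
  obtain ⟨rs, hlen, hmem, hreg⟩ := exists_weaklyRegularMod_span_pair_pow (n + 1) F P
    (irrelevantIdeal (n + 2) K) hF hP (two_le_height_of_dvd hF0 hdvd)
  -- With at least three variables the sequence is nonempty; its head lies in the irrelevant ideal,
  -- and its powers can be cancelled modulo `(F, P) ^ k`.
  obtain ⟨l, rs, rfl⟩ := List.exists_cons_of_length_eq_add_one hlen
  rintro f ⟨j, hj⟩
  have := hj (l ^ j) (Ideal.pow_mem_pow (hmem l (by simp)) j)
  clear hj
  induction j with
  | zero => simpa using this
  | succ j ih => exact ih ((hreg k).1 _ (by rwa [← mul_assoc, ← pow_succ']))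

theorem isCohenMacaulay_quotient_span_pair_pow
    (hF0 : F ≠ 0) (hdvd : ∀ f, F ∣ P * f → F ∣ f) {k : ℕ} (hk : k ≠ 0) :
    IsCohenMacaulay (MvPolynomial (Fin (n + 3)) K ⧸ Ideal.span {F, P} ^ k) := by
  refine isCohenMacaulay_quotient_of_weaklyRegularMod _ (n + 1) ?_ fun m hm hle ↦ ?_
  · have h := ringKrullDim_quotient_span_pair_pow_le hF0 hdvd hk
    rw [MvPolynomial.ringKrullDim_of_isNoetherianRing, ringKrullDim_eq_zero_of_field, zero_add,
      Nat.card_fin] at h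
    exact WithBot.le_natCast_of_add_two_le h
  · have hmp := hm.isPrime
    have hle' : Ideal.span {F, P} ≤ m := hmp.le_of_pow_le hle
    obtain ⟨rs, h1, h2, h3⟩ := exists_weaklyRegularMod_span_pair_pow (n + 1) F P m
      (hle' (Ideal.subset_span (by simp))) (hle' (Ideal.subset_span (by simp)))
      (two_le_height_of_dvd hF0 hdvd)
    exact ⟨rs, h1, h2, h3 k⟩

end CompleteIntersection

/-! ### Support and codimension -/

theorem zeroLocus_span_pair_pow {n : ℕ} {K : Type*} [Field K]
    (F P : MvPolynomial (Fin (n + 1)) K) {k : ℕ} (hk : k ≠ 0) :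
    ProjectiveSpectrum.zeroLocus (MvPolynomial.homogeneousSubmodule (Fin (n + 1)) K)
      (Ideal.span {F, P} ^ k : Ideal (MvPolynomial (Fin (n + 1)) K)) =
    ProjectiveSpectrum.zeroLocus (MvPolynomial.homogeneousSubmodule (Fin (n + 1)) K) {F, P} := by
  ext p
  rw [ProjectiveSpectrum.mem_zeroLocus, ProjectiveSpectrum.mem_zeroLocus]
  constructor
  · intro h
    have : Ideal.span {F, P} ≤ p.asHomogeneousIdeal.toIdeal := p.isPrime.le_of_pow_le h
    exact Ideal.span_le.1 this
  · intro h
    exact (Ideal.pow_le_self hk).trans (Ideal.span_le.2 h :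
      Ideal.span {F, P} ≤ p.asHomogeneousIdeal.toIdeal)

theorem iInf_height_zeroLocus_pair {n d : ℕ} (hn : 2 ≤ n) {K : Type*} [Field K]
    {F P : MvPolynomial (Fin (n + 1)) K} (hF : F.IsHomogeneous d) (hP : P.IsHomogeneous d)
    (hF0 : F ≠ 0) (hdvd : ∀ f, F ∣ P * f → F ∣ f) (hne : Ideal.span {F, P} ≠ ⊤) :
    ⨅ p ∈ ProjectiveSpectrum.zeroLocus (MvPolynomial.homogeneousSubmodule (Fin (n + 1)) K) {F, P},
      p.asHomogeneousIdeal.toIdeal.height = 2 := by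
  refine le_antisymm ?_ (le_iInf₂ fun p hp ↦ ?_)
  · obtain ⟨m, hm, hIm⟩ := Ideal.exists_le_maximal _ hne
    have := hm.isPrime
    obtain ⟨p, hp, -⟩ := Ideal.exists_minimalPrimes_le hIm
    have hph := (Ideal.isHomogeneous_span_pair hF hP).of_mem_minimalPrimes _ hp
    have hht := Ideal.height_le_two_of_mem_minimalPrimes hp
    -- A minimal prime is a point of projective space because the irrelevant ideal has height `n + 1
    -- > 2`.
    suffices hirr : ¬ HomogeneousIdeal.irrelevant
        (MvPolynomial.homogeneousSubmodule (Fin (n + 1)) K) ≤ ⟨p, hph⟩ by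
      let x : ProjectiveSpectrum (MvPolynomial.homogeneousSubmodule (Fin (n + 1)) K) :=
        ⟨⟨p, hph⟩, hp.1.1, hirr⟩
      have hx : x ∈ ProjectiveSpectrum.zeroLocus
          (MvPolynomial.homogeneousSubmodule (Fin (n + 1)) K) {F, P} := by
        rw [ProjectiveSpectrum.mem_zeroLocus]
        exact Ideal.span_le.1 hp.1.2
      exact le_trans (iInf₂_le x hx) hht
    intro hle
    have hirr : irrelevantIdeal n K ≤ p := by
      refine Ideal.span_le.2 ?_
      rintro _ ⟨i, rfl⟩
      have hX : (MvPolynomial.X i : MvPolynomial (Fin (n + 1)) K) ∈ HomogeneousIdeal.irrelevant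
          (MvPolynomial.homogeneousSubmodule (Fin (n + 1)) K) :=
        HomogeneousIdeal.mem_irrelevant_of_mem _ one_pos (MvPolynomial.isHomogeneous_X K i)
      exact hle hX
    have h := (Ideal.height_mono hirr).trans hht
    rw [MvPolynomial.height_of_isMaximal] at h
    have : n + 1 ≤ 2 := by exact_mod_cast h
    omega
  · have hp' : {F, P} ⊆ (p.asHomogeneousIdeal.toIdeal : Set (MvPolynomial (Fin (n + 1)) K)) := hp
    exact two_le_height_of_dvd hF0 hdvd _ p.isPrime (hp' (by simp)) (hp' (by simp))

theorem MvPolynomial.IsHomogeneous.ne_zero_of_span_ne_top {n d : ℕ} {K : Type*} [Field K]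
    {F P : MvPolynomial (Fin (n + 1)) K} (hF : F.IsHomogeneous d) (hF0 : F ≠ 0)
    (hne : Ideal.span {F, P} ≠ ⊤) : d ≠ 0 := by
  rintro rfl
  have h := MvPolynomial.totalDegree_eq_zero_iff_eq_C.1 (hF.totalDegree hF0)
  refine hne (Ideal.eq_top_of_isUnit_mem _ (Ideal.subset_span (by simp : F ∈ {F, P})) ?_)
  rw [h]
  refine IsUnit.map _ (isUnit_iff_ne_zero.2 fun h0 ↦ hF0 ?_)
  rw [h, h0, MvPolynomial.C_0]

/-! ### Hilbert functions and Hilbert polynomials -/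

section HilbertFunction

variable {n : ℕ} {K : Type*} [Field K]

/-- The graded piece of degree `t` of the ideal `J`, as a subspace of the forms of degree `t`. -/
noncomputable def idealPiece (J : Ideal (MvPolynomial (Fin (n + 1)) K)) (t : ℕ) :
    Submodule K (MvPolynomial.homogeneousSubmodule (Fin (n + 1)) K t) :=
  (J.restrictScalars K).comap (MvPolynomial.homogeneousSubmodule (Fin (n + 1)) K t).subtype

theorem mem_idealPiece {J : Ideal (MvPolynomial (Fin (n + 1)) K)} {t : ℕ}
    {x : MvPolynomial.homogeneousSubmodule (Fin (n + 1)) K t} :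
    x ∈ idealPiece J t ↔ x.1 ∈ J := Iff.rfl

instance finite_homogeneousSubmodule (t : ℕ) :
    Module.Finite K (MvPolynomial.homogeneousSubmodule (Fin (n + 1)) K t) :=
  Module.Finite.iff_fg.2 (MvPolynomial.homogeneousSubmodule_fg _ _ t)

theorem finrank_homogeneousSubmodule (t : ℕ) :
    Module.finrank K (MvPolynomial.homogeneousSubmodule (Fin (n + 1)) K t) =
      (t + n).choose n := by
  have h : MvPolynomial.homogeneousSubmodule (Fin (n + 1)) K t =
      MvPolynomial.restrictSupport K {d | d.degree = t} :=
    MvPolynomial.homogeneousSubmodule_eq_finsupp_supported _ _ t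
  have hset : {d : Fin (n + 1) →₀ ℕ | d.degree = t} =
      (Finset.finsuppAntidiag (Finset.univ : Finset (Fin (n + 1))) t : Set _) := by
    ext d
    simp [Finset.mem_finsuppAntidiag, Finsupp.degree_eq_sum]
  rw [h, Module.finrank_eq_nat_card_basis (MvPolynomial.basisRestrictSupport K _), hset,
    Nat.card_coe_set_eq, Set.ncard_coe_finset, Finset.card_finsuppAntidiag_nat_eq_choose,
    Finset.card_fin, show n + 1 + t - 1 = t + n by omega, Nat.choose_symm_add]

theorem finrank_quotient_idealPiece_bot (t : ℕ) :
    Module.finrank K (MvPolynomial.homogeneousSubmodule (Fin (n + 1)) K t ⧸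
      idealPiece (⊥ : Ideal (MvPolynomial (Fin (n + 1)) K)) t) = (t + n).choose n := by
  have : idealPiece (⊥ : Ideal (MvPolynomial (Fin (n + 1)) K)) t = ⊥ := by
    ext x
    rw [mem_idealPiece, Ideal.mem_bot, Submodule.mem_bot]
    exact Submodule.coe_eq_zero
  rw [← finrank_homogeneousSubmodule (K := K), this]
  exact (Submodule.quotEquivOfEqBot _ rfl).finrank_eq

/-- Dimension count in `0 → (S/J')_t → (S/J)_(e+t) → (S/(J + (f)))_(e+t) → 0`, whose first map is
multiplication by `f`, where `J' = J : f`. -/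
theorem finrank_quotient_idealPiece_sup {J J' : Ideal (MvPolynomial (Fin (n + 1)) K)}
    (hJ : J.IsHomogeneous (MvPolynomial.homogeneousSubmodule (Fin (n + 1)) K))
    {f : MvPolynomial (Fin (n + 1)) K} {e : ℕ} (hf : f.IsHomogeneous e)
    (hcolon : ∀ g, f * g ∈ J ↔ g ∈ J') (t : ℕ) :
    Module.finrank K (MvPolynomial.homogeneousSubmodule (Fin (n + 1)) K (e + t) ⧸
        idealPiece (J ⊔ Ideal.span {f}) (e + t)) +
      Module.finrank K (MvPolynomial.homogeneousSubmodule (Fin (n + 1)) K t ⧸ idealPiece J' t) =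
      Module.finrank K (MvPolynomial.homogeneousSubmodule (Fin (n + 1)) K (e + t) ⧸
        idealPiece J (e + t)) := by
  let S := MvPolynomial.homogeneousSubmodule (Fin (n + 1)) K
  let μ : S t →ₗ[K] S (e + t) := (LinearMap.mulLeft K f).restrict fun x hx ↦ hf.mul hx
  let ν : S t →ₗ[K] S (e + t) ⧸ idealPiece J (e + t) := (idealPiece J (e + t)).mkQ ∘ₗ μ
  have hker : ν.ker = idealPiece J' t := by
    ext x
    rw [LinearMap.mem_ker, LinearMap.comp_apply, Submodule.mkQ_apply,
      Submodule.Quotient.mk_eq_zero, mem_idealPiece, mem_idealPiece, ← hcolon]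
    rfl
  let π := ν.range.mkQ ∘ₗ (idealPiece J (e + t)).mkQ
  have hπ : Function.Surjective π :=
    (Submodule.mkQ_surjective _).comp (Submodule.mkQ_surjective _)
  have hkerπ : π.ker = idealPiece (J ⊔ Ideal.span {f}) (e + t) := by
    ext x
    rw [LinearMap.mem_ker, LinearMap.comp_apply, Submodule.mkQ_apply,
      Submodule.Quotient.mk_eq_zero, mem_idealPiece]
    constructor
    · rintro ⟨a, ha⟩
      have h1 : μ a - x ∈ idealPiece J (e + t) := (Submodule.Quotient.eq _).1 ha
      have h2 : f * a.1 - x.1 ∈ J := h1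
      rw [← sub_sub_cancel (f * a.1) x.1]
      exact sub_mem (Ideal.mem_sup_right (Ideal.mem_span_singleton.2 ⟨_, rfl⟩))
        (Ideal.mem_sup_left h2)
    · intro hx
      obtain ⟨j, hj, y, hy, hjy⟩ := Submodule.mem_sup.1 hx
      obtain ⟨b, rfl⟩ := Ideal.mem_span_singleton.1 hy
      -- The cofactor `b` need not be homogeneous; only its component of degree `t` contributes.
      refine ⟨DirectSum.decompose S b t, (Submodule.Quotient.eq _).2 ?_⟩
      change f * (DirectSum.decompose S b t : MvPolynomial (Fin (n + 1)) K) - x.1 ∈ J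
      have h1 : (DirectSum.decompose S x.1 (e + t) : MvPolynomial (Fin (n + 1)) K) = x.1 :=
        DirectSum.decompose_of_mem_same S x.2
      rw [← hjy, DirectSum.decompose_add, DirectSum.add_apply, Submodule.coe_add,
        DirectSum.coe_decompose_mul_add_of_left_mem S hf, hjy] at h1
      rw [← h1, sub_add_cancel_right]
      exact neg_mem (hJ _ hj)
  rw [← hkerπ, ← hker, (π.quotKerEquivOfSurjective hπ).finrank_eq,
    ν.quotKerEquivRange.finrank_eq]
  exact Submodule.finrank_quotient_add_finrank _

/-- `p` is the Hilbert polynomial of `S / J`. -/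
def IsHilbertPolynomial (J : Ideal (MvPolynomial (Fin (n + 1)) K)) (p : Polynomial ℚ) : Prop :=
  ∀ᶠ t : ℕ in Filter.atTop,
    (Module.finrank K (MvPolynomial.homogeneousSubmodule (Fin (n + 1)) K t ⧸ idealPiece J t) : ℚ) =
      p.eval (t : ℚ)

theorem isHilbertPolynomial_bot :
    IsHilbertPolynomial (⊥ : Ideal (MvPolynomial (Fin (n + 1)) K))
      (Polynomial.preHilbertPoly ℚ n 0) :=
  Filter.Eventually.of_forall fun t ↦ by
    rw [finrank_quotient_idealPiece_bot, Polynomial.preHilbertPoly_eq_choose_sub_add ℚ n (zero_le),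
      Nat.sub_zero]

theorem isHilbertPolynomial_top :
    IsHilbertPolynomial (⊤ : Ideal (MvPolynomial (Fin (n + 1)) K)) 0 :=
  Filter.Eventually.of_forall fun t ↦ by
    have : idealPiece (⊤ : Ideal (MvPolynomial (Fin (n + 1)) K)) t = ⊤ := rfl
    rw [this, Polynomial.eval_zero, Module.finrank_zero_of_subsingleton, Nat.cast_zero]

theorem IsHilbertPolynomial.eventually_eq {J J' : Ideal (MvPolynomial (Fin (n + 1)) K)}
    {p' : Polynomial ℚ}
    (hJ : J.IsHomogeneous (MvPolynomial.homogeneousSubmodule (Fin (n + 1)) K))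
    {f : MvPolynomial (Fin (n + 1)) K} {e : ℕ} (hf : f.IsHomogeneous e)
    (hcolon : ∀ g, f * g ∈ J ↔ g ∈ J') (hp' : IsHilbertPolynomial J' p') :
    ∀ᶠ t : ℕ in Filter.atTop,
      (Module.finrank K (MvPolynomial.homogeneousSubmodule (Fin (n + 1)) K t ⧸
        idealPiece (J ⊔ Ideal.span {f}) t) : ℚ) + (p'.comp (.X - .C (e : ℚ))).eval (t : ℚ) =
      Module.finrank K (MvPolynomial.homogeneousSubmodule (Fin (n + 1)) K t ⧸ idealPiece J t) := by
  filter_upwards [Filter.tendsto_sub_atTop_nat e |>.eventually hp', Filter.eventually_ge_atTop e]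
    with t ht hte
  obtain ⟨t, rfl⟩ := Nat.exists_eq_add_of_le hte
  rw [Nat.add_sub_cancel_left] at ht
  rw [← finrank_quotient_idealPiece_sup hJ hf hcolon t, Polynomial.eval_comp, Nat.cast_add (Module.finrank K _),
    ht]
  simp

theorem IsHilbertPolynomial.sup {J J' : Ideal (MvPolynomial (Fin (n + 1)) K)}
    {p p' : Polynomial ℚ}
    (hJ : J.IsHomogeneous (MvPolynomial.homogeneousSubmodule (Fin (n + 1)) K))
    {f : MvPolynomial (Fin (n + 1)) K} {e : ℕ} (hf : f.IsHomogeneous e)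
    (hcolon : ∀ g, f * g ∈ J ↔ g ∈ J') (hp : IsHilbertPolynomial J p)
    (hp' : IsHilbertPolynomial J' p') :
    IsHilbertPolynomial (J ⊔ Ideal.span {f}) (p - p'.comp (.X - .C (e : ℚ))) := by
  filter_upwards [hp, hp'.eventually_eq hJ hf hcolon] with t h1 h2
  rw [Polynomial.eval_sub, ← h1, ← h2, add_sub_cancel_right]

theorem IsHilbertPolynomial.of_sup {J J' : Ideal (MvPolynomial (Fin (n + 1)) K)}
    {q p' : Polynomial ℚ}
    (hJ : J.IsHomogeneous (MvPolynomial.homogeneousSubmodule (Fin (n + 1)) K))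
    {f : MvPolynomial (Fin (n + 1)) K} {e : ℕ} (hf : f.IsHomogeneous e)
    (hcolon : ∀ g, f * g ∈ J ↔ g ∈ J') (hq : IsHilbertPolynomial (J ⊔ Ideal.span {f}) q)
    (hp' : IsHilbertPolynomial J' p') :
    IsHilbertPolynomial J (q + p'.comp (.X - .C (e : ℚ))) := by
  filter_upwards [hq, hp'.eventually_eq hJ hf hcolon] with t h1 h2
  rw [Polynomial.eval_add, ← h1, ← h2]

end HilbertFunction

/-! ### Leading coefficients and the degree of `(F, P) ^ k` -/

open Polynomial in
theorem Polynomial.coeff_comp_X_sub_C {p : ℚ[X]} {m : ℕ} (hp : p.natDegree ≤ m + 1) (e : ℚ) :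
    (p.comp (X - C e)).coeff m = p.coeff m - e * (m + 1) * p.coeff (m + 1) := by
  have h : hasseDeriv m p = C (p.coeff m) + C ((m + 1) * p.coeff (m + 1)) * X := by
    ext k
    rw [hasseDeriv_coeff]
    rcases k with _ | _ | k
    · simp
    · simp [add_comm 1 m]
    · rw [coeff_eq_zero_of_natDegree_lt (by omega)]
      simp [coeff_one]
  rw [sub_eq_add_neg, ← C_neg, ← taylor_apply, taylor_coeff, h]
  simp
  ring

open Polynomial in
theorem Polynomial.natDegree_comp_X_sub_C_le {p : ℚ[X]} {m : ℕ} (hp : p.natDegree ≤ m) (e : ℚ) :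
    (p.comp (X - C e)).natDegree ≤ m := by
  rw [natDegree_comp, natDegree_X_sub_C, mul_one]; exact hp

open Polynomial in
theorem Polynomial.natDegree_sub_comp_X_sub_C_le {p : ℚ[X]} {m : ℕ} (hp : p.natDegree ≤ m + 1)
    (e : ℚ) : (p - p.comp (X - C e)).natDegree ≤ m := by
  refine natDegree_le_iff_coeff_eq_zero.2 fun k hk ↦ ?_
  rw [coeff_sub, coeff_comp_X_sub_C (by omega), coeff_eq_zero_of_natDegree_lt (n := k + 1) (by omega)]
  ring

open Polynomial in
theorem Polynomial.coeff_sub_comp_X_sub_C {p : ℚ[X]} {m : ℕ} (hp : p.natDegree ≤ m + 1) (e : ℚ) :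
    (p - p.comp (X - C e)).coeff m = e * (m + 1) * p.coeff (m + 1) := by
  rw [coeff_sub, coeff_comp_X_sub_C hp]; ring

theorem Ideal.span_pair_pow_succ_sup_span_singleton {A : Type*} [CommRing A] (F P : A) (k : ℕ) :
    Ideal.span {F, P} ^ (k + 1) ⊔ Ideal.span {F} =
      (⊥ ⊔ Ideal.span {F}) ⊔ Ideal.span {P ^ (k + 1)} := by
  rw [Ideal.span_pair_pow_succ, bot_sup_eq, sup_right_comm,
    sup_eq_right.2 (Ideal.mul_le_left : Ideal.span {F} * Ideal.span {F, P} ^ k ≤ Ideal.span {F})]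

section CompleteIntersection

variable {K : Type*} [Field K] {m d : ℕ} {F P : MvPolynomial (Fin (m + 2 + 1)) K}

/-- Start from the Hilbert polynomial of `S` and take differences with steps `d` and `j * d`, one
for each of the regular elements `F` and `P ^ j`. -/
theorem exists_isHilbertPolynomial_span_sup (hF : F.IsHomogeneous d) (hP : P.IsHomogeneous d)
    (hF0 : F ≠ 0) (hdvd : ∀ f, F ∣ P * f → F ∣ f) (j : ℕ) :
    ∃ q : Polynomial ℚ, IsHilbertPolynomial ((⊥ ⊔ Ideal.span {F}) ⊔ Ideal.span {P ^ j}) q ∧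
      q.natDegree ≤ m ∧ q.coeff m = j * d ^ 2 / m.factorial := by
  have hbot : (⊥ : Ideal (MvPolynomial (Fin (m + 2 + 1)) K)).IsHomogeneous
      (MvPolynomial.homogeneousSubmodule (Fin (m + 2 + 1)) K) := Ideal.IsHomogeneous.bot _
  have h1 := isHilbertPolynomial_bot.sup hbot hF (J' := ⊥) (fun g ↦ by simp [hF0])
    isHilbertPolynomial_bot
  have hhom : (⊥ ⊔ Ideal.span {F}).IsHomogeneous
      (MvPolynomial.homogeneousSubmodule (Fin (m + 2 + 1)) K) := by
    rw [bot_sup_eq]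
    exact Ideal.homogeneous_span _ _ (by rintro x rfl; exact ⟨d, hF⟩)
  have h2 := h1.sup hhom (hP.pow j) (J' := ⊥ ⊔ Ideal.span {F}) (fun g ↦ by
    rw [bot_sup_eq, Ideal.mem_span_singleton, Ideal.mem_span_singleton]
    exact ⟨dvd_of_dvd_pow_mul hdvd j g, fun h ↦ h.mul_left _⟩) h1
  have hd0 := (Polynomial.natDegree_preHilbertPoly ℚ (m + 2) 0).le
  have hd1 := Polynomial.natDegree_sub_comp_X_sub_C_le hd0 (d : ℚ)
  refine ⟨_, h2, Polynomial.natDegree_sub_comp_X_sub_C_le hd1 _, ?_⟩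
  rw [Polynomial.coeff_sub_comp_X_sub_C hd1, Polynomial.coeff_sub_comp_X_sub_C hd0,
    Polynomial.coeff_preHilbertPoly_self, Nat.factorial_succ, Nat.factorial_succ]
  have := Nat.factorial_ne_zero m
  push_cast
  field_simp

theorem exists_isHilbertPolynomial_span_pair_pow (hF : F.IsHomogeneous d) (hP : P.IsHomogeneous d)
    (hF0 : F ≠ 0) (hdvd : ∀ f, F ∣ P * f → F ∣ f) (k : ℕ) :
    ∃ p : Polynomial ℚ, IsHilbertPolynomial (Ideal.span {F, P} ^ k) p ∧
      p.natDegree ≤ m ∧ p.coeff m = (k + 1).choose 2 * d ^ 2 / m.factorial := by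
  induction k with
  | zero =>
    refine ⟨0, ?_, Nat.zero_le _, ?_⟩
    · rw [pow_zero, Ideal.one_eq_top]; exact isHilbertPolynomial_top
    · simp
  | succ k ih =>
    obtain ⟨p, hp, hdeg, hcoeff⟩ := ih
    obtain ⟨q, hq, hqdeg, hqcoeff⟩ := exists_isHilbertPolynomial_span_sup hF hP hF0 hdvd (k + 1)
    rw [← Ideal.span_pair_pow_succ_sup_span_singleton] at hq
    refine ⟨_, hq.of_sup ((Ideal.isHomogeneous_span_pair hF hP).pow_nat _) hF (fun g ↦
      ⟨Ideal.mem_span_pair_pow_of_mul_mem hF0 hdvd, fun hg ↦ ?_⟩) hp,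
      Polynomial.natDegree_add_le_of_degree_le hqdeg
        (Polynomial.natDegree_comp_X_sub_C_le hdeg _), ?_⟩
    · rw [pow_succ']
      exact Ideal.mul_mem_mul (Ideal.subset_span (by simp)) hg
    · rw [Polynomial.coeff_add, hqcoeff, Polynomial.coeff_comp_X_sub_C (hdeg.trans (Nat.le_succ m)),
        hcoeff, Polynomial.coeff_eq_zero_of_natDegree_lt (n := m + 1) (by omega),
        -- Pascal's rule absorbs the new summand `k + 1`; the shift by `d` leaves the coefficient of
        -- degree `m` unchanged, since `p` has degree at most `m`.
        Nat.choose_succ_succ' (k + 1) 1, Nat.choose_one_right]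
      push_cast
      ring

end CompleteIntersection

theorem ProjSubscheme.hasDegree_of_isHilbertPolynomial {n : ℕ} {K : Type*} [Field K]
    (V : ProjSubscheme n K) {p : Polynomial ℚ} (hp : IsHilbertPolynomial V.ideal p) {m e : ℕ}
    (he : e ≠ 0) (hdeg : p.natDegree ≤ m) (hcoeff : p.coeff m = e / m.factorial) :
    V.HasDegree e := by
  have hm : (m.factorial : ℚ) ≠ 0 := Nat.cast_ne_zero.2 (Nat.factorial_ne_zero m)
  have hnat : p.natDegree = m := le_antisymm hdeg (Polynomial.le_natDegree_of_ne_zero (by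
    rw [hcoeff]; exact div_ne_zero (Nat.cast_ne_zero.2 he) hm))
  refine ⟨p, hp, ?_⟩
  rw [Polynomial.leadingCoeff, hnat, hcoeff]
  field_simp

/-! ### The ideal of the products `G / G_i` -/

/-- When `k` joins `T`, multiply the old product omitting `i` by `x = u * G i + v * G k` in `I`: the
first term yields the new product omitting `k`, the second the one omitting `i`. -/
theorem Ideal.pow_le_span_prod_erase {A ι : Type*} [CommRing A] [DecidableEq ι] (I : Ideal A)
    (G : ι → A) (T : Finset ι) (hT : T.Nonempty)
    (h : ∀ i ∈ T, ∀ k ∈ T, i ≠ k → I ≤ Ideal.span {G i, G k}) :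
    I ^ (T.card - 1) ≤ Ideal.span ((fun i ↦ ∏ j ∈ T.erase i, G j) '' T) := by
  induction hT using Finset.Nonempty.cons_induction with
  | singleton a => simp
  | cons k T hk hT ih =>
    have ih := ih fun i hi j hj ↦ h i (Finset.mem_cons_of_mem hi) j (Finset.mem_cons_of_mem hj)
    rw [Finset.card_cons, Nat.add_sub_cancel, ← Nat.sub_add_cancel hT.card_pos, pow_succ']
    refine (Ideal.mul_mono_right ih).trans (Ideal.mul_le.2 fun x hx y hy ↦ ?_)
    induction hy using Submodule.span_induction with
    | zero => rw [mul_zero]; exact Ideal.zero_mem _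
    | add y z _ _ h1 h2 => rw [mul_add]; exact Ideal.add_mem _ h1 h2
    | smul a y _ h1 => rw [smul_eq_mul, mul_left_comm]; exact Ideal.mul_mem_left _ _ h1
    | mem y hy =>
      obtain ⟨i, hi, rfl⟩ := hy
      have hik : i ≠ k := fun h ↦ hk (h ▸ hi)
      obtain ⟨u, v, rfl⟩ := Ideal.mem_span_pair.1
        (h i (Finset.mem_cons_of_mem hi) k (Finset.mem_cons_self k T) hik hx)
      have h1 : G i * ∏ j ∈ T.erase i, G j = ∏ j ∈ (Finset.cons k T hk).erase k, G j := by
        rw [Finset.mul_prod_erase T G hi, Finset.erase_cons]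
      have h2 : G k * ∏ j ∈ T.erase i, G j = ∏ j ∈ (Finset.cons k T hk).erase i, G j := by
        rw [Finset.erase_cons_of_ne hk hik.symm, Finset.prod_cons]
      have h3 : (u * G i + v * G k) * ∏ j ∈ T.erase i, G j =
          u * ∏ j ∈ (Finset.cons k T hk).erase k, G j +
            v * ∏ j ∈ (Finset.cons k T hk).erase i, G j := by
        rw [← h1, ← h2]; ring
      rw [h3]
      exact add_mem
        (Ideal.mul_mem_left _ _ (Ideal.subset_span ⟨k, Finset.mem_cons_self k T, rfl⟩))
        (Ideal.mul_mem_left _ _ (Ideal.subset_span ⟨i, Finset.mem_cons_of_mem hi, rfl⟩))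

theorem MvPolynomial.IsHomogeneous.exists_eq_C_mul_add_C_mul {n d : ℕ} {K : Type*} [Field K]
    {F P G : MvPolynomial (Fin (n + 1)) K} (hF : F.IsHomogeneous d) (hP : P.IsHomogeneous d)
    (hG : G.IsHomogeneous d) (hGI : G ∈ Ideal.span {F, P}) :
    ∃ a b : K, G = MvPolynomial.C a * F + MvPolynomial.C b * P := by
  obtain ⟨u, v, huv⟩ := Ideal.mem_span_pair.1 hGI
  let S := MvPolynomial.homogeneousSubmodule (Fin (n + 1)) K
  have hC : ∀ w : MvPolynomial (Fin (n + 1)) K, ∃ a : K,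
      (DirectSum.decompose S w 0 : MvPolynomial (Fin (n + 1)) K) = MvPolynomial.C a := fun w ↦
    ⟨_, MvPolynomial.totalDegree_eq_zero_iff_eq_C.1 (Nat.le_zero.1
      (MvPolynomial.IsHomogeneous.totalDegree_le (DirectSum.decompose S w 0).2))⟩
  obtain ⟨a, ha⟩ := hC u
  obtain ⟨b, hb⟩ := hC v
  refine ⟨a, b, ?_⟩
  have h : (DirectSum.decompose S G (d + 0) : MvPolynomial (Fin (n + 1)) K) = G :=
    DirectSum.decompose_of_mem_same S hG
  rw [← h, ← huv, mul_comm u, mul_comm v, DirectSum.decompose_add, DirectSum.add_apply,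
    Submodule.coe_add, DirectSum.coe_decompose_mul_add_of_left_mem S hF,
    DirectSum.coe_decompose_mul_add_of_left_mem S hP, ha, hb]
  ring

theorem Ideal.span_singleton_eq_of_det_eq_zero {σ K : Type*} [Field K]
    {F P G H : MvPolynomial σ K} {a b a' b' : K}
    (hG : G = MvPolynomial.C a * F + MvPolynomial.C b * P)
    (hH : H = MvPolynomial.C a' * F + MvPolynomial.C b' * P) (hG0 : G ≠ 0) (hH0 : H ≠ 0)
    (hdet : a * b' - a' * b = 0) : Ideal.span {G} = Ideal.span {H} := by
  have key : ∀ {x y : K}, x ≠ 0 → MvPolynomial.C x * G = MvPolynomial.C y * H →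
      Ideal.span {G} = Ideal.span {H} := fun {x y} hx hxy ↦ by
    have hy : y ≠ 0 := by
      rintro rfl
      rw [MvPolynomial.C_0, zero_mul, mul_eq_zero, MvPolynomial.C_eq_zero] at hxy
      exact hxy.elim hx hG0
    have hux : IsUnit (MvPolynomial.C x : MvPolynomial σ K) := (isUnit_iff_ne_zero.2 hx).map _
    have huy : IsUnit (MvPolynomial.C y : MvPolynomial σ K) := (isUnit_iff_ne_zero.2 hy).map _
    rw [← Ideal.span_singleton_mul_left_unit hux, hxy, Ideal.span_singleton_mul_left_unit huy]
  have hdet' : (MvPolynomial.C a * MvPolynomial.C b' : MvPolynomial σ K) =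
      MvPolynomial.C a' * MvPolynomial.C b := by
    rw [← MvPolynomial.C_mul, ← MvPolynomial.C_mul, sub_eq_zero.1 hdet]
  by_cases ha : a' = 0
  -- The vanishing determinant gives both `b' * G = b * H` and `a' * G = a * H`; as `H ≠ 0`, one of
  -- `a'`, `b'` is nonzero.
  · refine key (x := b') (y := b) (fun hb ↦ hH0 (by simp [hH, ha, hb])) ?_
    rw [hG, hH]; linear_combination F * hdet'
  · refine key (x := a') (y := a) ha ?_
    rw [hG, hH]; linear_combination -P * hdet'

theorem Ideal.span_pair_le_of_det_ne_zero {σ K : Type*} [Field K]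
    {F P G H : MvPolynomial σ K} {a b a' b' : K}
    (hG : G = MvPolynomial.C a * F + MvPolynomial.C b * P)
    (hH : H = MvPolynomial.C a' * F + MvPolynomial.C b' * P)
    (hdet : a * b' - a' * b ≠ 0) : Ideal.span {F, P} ≤ Ideal.span {G, H} := by
  set D := a * b' - a' * b
  have hD : (MvPolynomial.C D⁻¹ : MvPolynomial σ K) * (MvPolynomial.C a * MvPolynomial.C b' -
      MvPolynomial.C a' * MvPolynomial.C b) = 1 := by
    rw [← MvPolynomial.C_mul, ← MvPolynomial.C_mul, ← MvPolynomial.C_sub, ← MvPolynomial.C_mul,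
      inv_mul_cancel₀ hdet, MvPolynomial.C_1]
  rw [Ideal.span_le]
  rintro x (rfl | rfl)
  · refine Ideal.mem_span_pair.2
      ⟨MvPolynomial.C D⁻¹ * MvPolynomial.C b', -(MvPolynomial.C D⁻¹ * MvPolynomial.C b), ?_⟩
    rw [hG, hH]; linear_combination x * hD
  · refine Ideal.mem_span_pair.2
      ⟨-(MvPolynomial.C D⁻¹ * MvPolynomial.C a'), MvPolynomial.C D⁻¹ * MvPolynomial.C a, ?_⟩
    rw [hG, hH]; linear_combination x * hD

theorem span_pair_pow_eq_span_prod_erase {K : Type*} [Field K] {n d s : ℕ} (hs : 1 ≤ s)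
    {F P : MvPolynomial (Fin (n + 1)) K} (hF : F.IsHomogeneous d) (hP : P.IsHomogeneous d)
    (G : Fin s → MvPolynomial (Fin (n + 1)) K) (hG0 : ∀ i, G i ≠ 0)
    (hGd : ∀ i, (G i).IsHomogeneous d) (hGI : ∀ i, G i ∈ Ideal.span {F, P})
    (hGinj : ∀ i j, i ≠ j → Ideal.span {G i} ≠ Ideal.span {G j}) :
    Ideal.span {F, P} ^ (s - 1) =
      Ideal.span (Set.range fun i => ∏ j ∈ Finset.univ.erase i, G j) := by
  choose a b hab using fun i ↦ hF.exists_eq_C_mul_add_C_mul hP (hGd i) (hGI i)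
  refine le_antisymm ?_ (Ideal.span_le.2 ?_)
  · have : Nonempty (Fin s) := ⟨⟨0, hs⟩⟩
    have h := Ideal.pow_le_span_prod_erase (Ideal.span {F, P}) G Finset.univ Finset.univ_nonempty
      fun i _ k _ hik ↦ Ideal.span_pair_le_of_det_ne_zero (hab i) (hab k) fun hdet ↦
        hGinj i k hik (Ideal.span_singleton_eq_of_det_eq_zero (hab i) (hab k) (hG0 i) (hG0 k) hdet)
    rwa [Finset.card_fin, Finset.coe_univ, Set.image_univ] at h
  · rintro _ ⟨i, rfl⟩
    have h := Ideal.prod_mem_prod (s := Finset.univ.erase i) (I := fun _ ↦ Ideal.span {F, P})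
      (x := G) (fun j _ ↦ hGI j)
    rwa [Finset.prod_const, Finset.card_erase_of_mem (Finset.mem_univ i), Finset.card_fin] at h

theorem lemma3p4 {K : Type*} [Field K] [IsAlgClosed K] [CharZero K] (n d s : ℕ) (hs : 1 ≤ s)
    (F P : MvPolynomial (Fin (n + 1)) K)
    (hF : F.IsHomogeneous d) (hP : P.IsHomogeneous d)
    (hreg : RingTheory.Sequence.IsRegular (MvPolynomial (Fin (n + 1)) K) [F, P])
    (hsmooth : IsSmoothIntersection F P)
    (G : Fin s → MvPolynomial (Fin (n + 1)) K)
    (hG0 : ∀ i, G i ≠ 0)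
    (hGd : ∀ i, (G i).IsHomogeneous d)
    (hGI : ∀ i, G i ∈ Ideal.span {F, P})
    -- the hypersurfaces defined by the `G i` are pairwise distinct
    (hGinj : ∀ i j, i ≠ j → Ideal.span {G i} ≠ Ideal.span {G j}) :
    -- `∏ j ∈ univ.erase i, G j` is `G / G_i`
    Ideal.span {F, P} ^ (s - 1) =
        Ideal.span (Set.range fun i => ∏ j ∈ Finset.univ.erase i, G j) ∧
      (2 ≤ n → 2 ≤ s →
        ∃ V : ProjSubscheme n K,
          V.ideal = Ideal.span (Set.range fun i => ∏ j ∈ Finset.univ.erase i, G j) ∧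
          V.IsACM ∧
          V.codim = 2 ∧
          V.support = ProjectiveSpectrum.zeroLocus
            (MvPolynomial.homogeneousSubmodule (Fin (n + 1)) K) {F, P} ∧
          V.HasDegree (s.choose 2 * d ^ 2)) := by
  have hpow := span_pair_pow_eq_span_prod_erase hs hF hP G hG0 hGd hGI hGinj
  refine ⟨hpow, fun hn hs2 ↦ ?_⟩
  obtain ⟨hF0, hdvd⟩ := ne_zero_and_dvd_of_isWeaklyRegular hreg.toIsWeaklyRegular
  have hne : Ideal.span {F, P} ≠ ⊤ := fun h ↦ hreg.top_ne_smul (by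
    rw [smul_eq_mul, Ideal.mul_top]
    simpa [Ideal.span_insert] using h.symm)
  have hd : d ≠ 0 := hF.ne_zero_of_span_ne_top hF0 hne
  have hk : s - 1 ≠ 0 := by omega
  obtain ⟨m, rfl⟩ := Nat.exists_eq_add_of_le' hn
  let V : ProjSubscheme (m + 2) K :=
    { ideal := Ideal.span {F, P} ^ (s - 1)
      homogeneous := (Ideal.isHomogeneous_span_pair hF hP).pow_nat _
      saturated := isSaturatedIdeal_span_pair_pow hF0 hdvd (hF.mem_irrelevantIdeal hd)
        (hP.mem_irrelevantIdeal hd) _ }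
  have hsupp : V.support = ProjectiveSpectrum.zeroLocus
      (MvPolynomial.homogeneousSubmodule (Fin (m + 2 + 1)) K) {F, P} :=
    zeroLocus_span_pair_pow F P hk
  obtain ⟨p, hp, hdeg, hcoeff⟩ := exists_isHilbertPolynomial_span_pair_pow hF hP hF0 hdvd (s - 1)
  rw [Nat.sub_add_cancel hs] at hcoeff
  refine ⟨V, hpow, isCohenMacaulay_quotient_span_pair_pow hF0 hdvd hk, ?_, hsupp,
    V.hasDegree_of_isHilbertPolynomial hp ?_ hdeg (by rw [hcoeff]; push_cast; rfl)⟩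
  · rw [ProjSubscheme.codim, hsupp]
    exact iInf_height_zeroLocus_pair hn hF hP hF0 hdvd hne
  · exact mul_ne_zero (Nat.choose_pos hs2).ne' (pow_ne_zero _ hd)
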